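/- **Setting.** Let $X$, $U$ be Banach spaces over $\mathbb K\in\{\mathbb R,\mathbb C\}$, let $A$ be the generator of a $C_0$-semigroup $(T(t))_{t\ge0}$ on $X$, let $\lambda\in\rho(A)$, and let $X_{-1}$ be the completion of $X$ with respect to the norm $\|x\|_{-1}=\|(\lambda I-A)^{-1}x\|$; $T(t)$ extends uniquely to a bounded operator $T_{-1}(t)$ on $X_{-1}$. Let $B:U\to X_{-1}$ be a bounded linear operator. $\Sigma(A,B)$ denotes the system $\dot x=Ax+Bu$, $x(0)=x_0$, whose mild solution is $x(t)=T(t)x_0+\int_0^tT_{-1}(t-s)Bu(s)\,ds\in X_{-1}$. A *Young function* is a function $\Phi(t)=\int_0^t\varphi(s)\,ds$, $t\ge0$, where $\varphi:[0,\infty)\to\mathbb R$ is right-continuous and nondecreasing, $\varphi(0)=0$, $\varphi(s)>0$ for $s>0$ and $\varphi(s)\to\infty$ as $s\to\infty$. $L_\Phi(0,t;U)$ is the space of (classes of) Bochner-measurable $u:(0,t)\to U$ with $\int_0^t\Phi(\|u(s)\|/k)\,ds<\infty$ for some $k>0$, with the Luxemburg norm $\|u\|_\Phi=\inf\{k>0:\int_0^t\Phi(\|u(s)\|/k)\,ds\le1\}$,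 and $E_\Phi(0,t;U)$ is the closure of $L^\infty(0,t;U)$ in $L_\Phi(0,t;U)$. $\mathcal K$ is the set of continuous strictly increasing $\mu:[0,\infty)\to[0,\infty)$ with $\mu(0)=0$; $\mathcal K_\infty$ is the set of unbounded $\theta\in\mathcal K$; $\mathcal L$ is the set of continuous strictly decreasing $\gamma:[0,\infty)\to[0,\infty)$ with $\lim_{t\to\infty}\gamma(t)=0$. - $\Sigma(A,B)$ is *(finite-time) $E_\Phi$-admissible* if $\int_0^tT_{-1}(s)Bu(s)\,ds\in X$ for all $t>0$ and $u\in E_\Phi(0,t;U)$. It is *infinite-time $E_\Phi$-admissible* if, in addition, there is $c\ge0$ with $\|\int_0^tT_{-1}(s)Bu(s)\,ds\|_X\le c\,\|u\|_\Phi$ for all $t>0$ and $u\in E_\Phi(0,t;U)$. - $\Sigma(A,B)$ is *$E_\Phi$-sISS* if there are $\mu\in\mathcal K$ and $\beta:X\times[0,\infty)\to[0,\infty)$ with $\beta(x,\cdot)\in\mathcal L$ for all $x\ne0$ such that $x(t)\in X$ and $\|x(t)\|\le\beta(x_0,t)+\mu(\|u\|_\Phi)$ for all $t\ge0$, $x_0\in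 X$, $u\in E_\Phi(0,t;U)$. - $\Sigma(A,B)$ is *siISS with $\mu\in\mathcal K$* if there are $\theta\in\mathcal K_\infty$ and $\beta:X\times[0,\infty)\to[0,\infty)$ with $\beta(x,\cdot)\in\mathcal L$ for all $x\ne0$ such that $x(t)\in X$ and $$\|x(t)\|\le\beta(x_0,t)+\theta\Big(\int_0^t\mu(\|u(s)\|_U)\,ds\Big)\quad\text{for all }t\ge0,\ x_0\in X,\ u\in L^\infty(0,t;U).$$ It is *siISS* if it is siISS with some $\mu\in\mathcal K$. **Theorem.** If $\Sigma(A,B)$ is siISS, then there is a Young function $\Phi$ such that $\Sigma(A,B)$ is $E_\Phi$-admissible. Moreover, if $\Sigma(A,B)$ is siISS with a function $\mu$ that is a Young function, then $\Sigma(A,B)$ is $E_\mu$-sISS, and it is infinite-time $E_\mu$-admissible. -/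

import Mathlib

open MeasureTheory Filter Topology Set
open scoped NNReal ENNReal

namespace LinSys

noncomputable section

/-! Strongly continuous semigroups, generators and resolvents -/

/-- A `C₀`-semigroup on `X`. -/
structure C0Semigroup (𝕜 : Type*) [RCLike 𝕜] (X : Type*) [NormedAddCommGroup X]
    [NormedSpace 𝕜 X] where
  /-- the operators of the semigroup -/
  op : ℝ≥0 → X →L[𝕜] X
  op_zero : op 0 = ContinuousLinearMap.id 𝕜 X
  op_add : ∀ s t : ℝ≥0, op (s + t) = (op s).comp (op t)
  continuous_orbit : ∀ x : X, Continuous fun t : ℝ≥0 => op t x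

/-- The resolvent set of an unbounded operator `A`: the scalars `lam` for which
`lam - A : D(A) → X` has an everywhere defined bounded two-sided inverse `R`. -/
def resolventSet {𝕜 : Type*} [RCLike 𝕜] {X : Type*} [NormedAddCommGroup X]
    [NormedSpace 𝕜 X] (A : X →ₗ.[𝕜] X) : Set 𝕜 :=
  {lam | ∃ R : X →L[𝕜] X,
    (∀ x : X, ∃ h : R x ∈ A.domain, lam • R x - A ⟨R x, h⟩ = x) ∧
    ∀ x : A.domain, R (lam • (x : X) - A x) = x}

namespace C0Semigroup

variable {𝕜 : Type*} [RCLike 𝕜] {X : Type*} [NormedAddCommGroup X] [NormedSpace 𝕜 X]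

/-- `y = lim_{h ↓ 0} (T(h) x - x) / h`, that is, `x ∈ D(A)` and `A x = y`. -/
def GenRel (T : C0Semigroup 𝕜 X) (x y : X) : Prop :=
  Tendsto (fun h : ℝ≥0 => (((h : ℝ) : 𝕜))⁻¹ • (T.op h x - x)) (𝓝[>] (0 : ℝ≥0)) (𝓝 y)

theorem GenRel.unique {T : C0Semigroup 𝕜 X} {x y z : X} (h₁ : T.GenRel x y)
    (h₂ : T.GenRel x z) : y = z :=
  tendsto_nhds_unique h₁ h₂

theorem GenRel.add {T : C0Semigroup 𝕜 X} {x y x' y' : X} (h₁ : T.GenRel x y)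
    (h₂ : T.GenRel x' y') : T.GenRel (x + x') (y + y') := by
  refine (Tendsto.add h₁ h₂).congr fun h => ?_
  rw [map_add, ← smul_add]
  congr 1
  abel

theorem GenRel.smul {T : C0Semigroup 𝕜 X} {x y : X} (c : 𝕜) (h₁ : T.GenRel x y) :
    T.GenRel (c • x) (c • y) := by
  refine (Tendsto.const_smul h₁ c).congr fun h => ?_
  rw [map_smul, ← smul_sub, smul_comm]

theorem GenRel.zero (T : C0Semigroup 𝕜 X) : T.GenRel 0 0 := by
  simp [GenRel]

theorem GenRel.op {T : C0Semigroup 𝕜 X} {x y : X} (t : ℝ≥0) (h₁ : T.GenRel x y) :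
    T.GenRel (T.op t x) (T.op t y) := by
  refine (((T.op t).continuous.tendsto y).comp h₁).congr fun h => ?_
  have e : T.op h (T.op t x) = T.op t (T.op h x) := by
    rw [← ContinuousLinearMap.comp_apply, ← ContinuousLinearMap.comp_apply, ← T.op_add,
      ← T.op_add, add_comm]
  simp only [Function.comp_apply, map_smul, map_sub, e]

/-- The (infinitesimal) generator `A` of the semigroup, an unbounded operator. -/
def generator (T : C0Semigroup 𝕜 X) : X →ₗ.[𝕜] X where
  domain :=
    { carrier := {x | ∃ y, T.GenRel x y}
      add_mem' := fun ⟨_, ha⟩ ⟨_, hb⟩ => ⟨_, ha.add hb⟩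
      zero_mem' := ⟨0, GenRel.zero T⟩
      smul_mem' := fun c _ ⟨_, hx⟩ => ⟨_, hx.smul c⟩ }
  toFun :=
    { toFun := fun x => Classical.choose x.2
      map_add' := fun a b => (Classical.choose_spec (a + b).2).unique
        ((Classical.choose_spec a.2).add (Classical.choose_spec b.2))
      map_smul' := fun c a => (Classical.choose_spec (c • a).2).unique
        ((Classical.choose_spec a.2).smul c) }

theorem genRel_generator (T : C0Semigroup 𝕜 X) (x : T.generator.domain) :
    T.GenRel x (T.generator x) :=
  Classical.choose_spec x.2

/-- The resolvent `(lam - A)⁻¹` of the generator at a point `lam` of its resolvent set. -/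
def resolvent (T : C0Semigroup 𝕜 X) (lam : resolventSet T.generator) : X →L[𝕜] X :=
  Classical.choose lam.2

theorem resolvent_right (T : C0Semigroup 𝕜 X) (lam : resolventSet T.generator) (x : X) :
    ∃ h : T.resolvent lam x ∈ T.generator.domain,
      (lam : 𝕜) • T.resolvent lam x - T.generator ⟨T.resolvent lam x, h⟩ = x :=
  (Classical.choose_spec lam.2).1 x

theorem resolvent_left (T : C0Semigroup 𝕜 X) (lam : resolventSet T.generator)
    (x : T.generator.domain) :
    T.resolvent lam ((lam : 𝕜) • (x : X) - T.generator x) = x :=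
  (Classical.choose_spec lam.2).2 x

theorem resolvent_injective (T : C0Semigroup 𝕜 X) (lam : resolventSet T.generator) :
    Function.Injective (T.resolvent lam) := by
  intro x y hxy
  obtain ⟨h, hx⟩ := T.resolvent_right lam x
  obtain ⟨h', hy⟩ := T.resolvent_right lam y
  rw [← hx, ← hy]
  simp only [hxy]

theorem resolvent_comm (T : C0Semigroup 𝕜 X) (lam : resolventSet T.generator) (t : ℝ≥0)
    (x : X) : T.resolvent lam (T.op t x) = T.op t (T.resolvent lam x) := by
  obtain ⟨h, hx⟩ := T.resolvent_right lam x
  have g := (T.genRel_generator ⟨_, h⟩).op t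
  have hm : T.op t (T.resolvent lam x) ∈ T.generator.domain := ⟨_, g⟩
  have e := (T.genRel_generator ⟨_, hm⟩).unique g
  have l := T.resolvent_left lam ⟨_, hm⟩
  rw [e, ← map_smul, ← map_sub, hx] at l
  exact l

/-! The extrapolation space `X₋₁` and the extrapolated semigroup `T₋₁` -/

/-- The vector space `X`, to be equipped with the norm `‖x‖₋₁ = ‖(lam - A)⁻¹ x‖`. -/
def PreExtrap (T : C0Semigroup 𝕜 X) (_lam : resolventSet T.generator) : Type _ := X

variable (T : C0Semigroup 𝕜 X) (lam : resolventSet T.generator)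

instance : AddCommGroup (PreExtrap T lam) := inferInstanceAs (AddCommGroup X)

instance : Module 𝕜 (PreExtrap T lam) := inferInstanceAs (Module 𝕜 X)

/-- The identity map of `X`, read as a map from `X` to `(X, ‖·‖₋₁)`. -/
def toPre : X ≃ₗ[𝕜] PreExtrap T lam := LinearEquiv.refl 𝕜 X

/-- The resolvent as a map `(X, ‖·‖₋₁) → X`. -/
def preResolvent : PreExtrap T lam →ₗ[𝕜] X :=
  (T.resolvent lam : X →ₗ[𝕜] X) ∘ₗ ((toPre T lam).symm : PreExtrap T lam →ₗ[𝕜] X)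

theorem preResolvent_injective : Function.Injective (preResolvent T lam) :=
  (T.resolvent_injective lam).comp (toPre T lam).symm.injective

instance : NormedAddCommGroup (PreExtrap T lam) :=
  NormedAddCommGroup.induced (PreExtrap T lam) X (preResolvent T lam)
    (preResolvent_injective T lam)

instance : NormedSpace 𝕜 (PreExtrap T lam) :=
  NormedSpace.induced 𝕜 (PreExtrap T lam) X (preResolvent T lam)

theorem norm_toPre (x : X) : ‖toPre T lam x‖ = ‖T.resolvent lam x‖ := rfl

/-- The extrapolation space `X₋₁`, the completion of `(X, ‖·‖₋₁)`. -/
def Extrap : Type _ := UniformSpace.Completion (PreExtrap T lam)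

instance : NormedAddCommGroup (Extrap T lam) :=
  inferInstanceAs (NormedAddCommGroup (UniformSpace.Completion (PreExtrap T lam)))

instance : NormedSpace 𝕜 (Extrap T lam) :=
  inferInstanceAs (NormedSpace 𝕜 (UniformSpace.Completion (PreExtrap T lam)))

instance : CompleteSpace (Extrap T lam) :=
  inferInstanceAs (CompleteSpace (UniformSpace.Completion (PreExtrap T lam)))

/-- The underlying real Banach space structure of `X₋₁`, used for Bochner integrals. -/
instance : NormedSpace ℝ (Extrap T lam) := NormedSpace.restrictScalars ℝ 𝕜 (Extrap T lam)

/-- The canonical (injective, dense, continuous) embedding `X → X₋₁`. -/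
def embed : X →L[𝕜] Extrap T lam :=
  (UniformSpace.Completion.toComplL :
      PreExtrap T lam →L[𝕜] UniformSpace.Completion (PreExtrap T lam)).comp
    ((toPre T lam : X →ₗ[𝕜] PreExtrap T lam).mkContinuous ‖T.resolvent lam‖
      fun x => (T.resolvent lam).le_opNorm x)

/-- `T(t)` as a bounded operator on `(X, ‖·‖₋₁)`. -/
def preOp (t : ℝ≥0) : PreExtrap T lam →L[𝕜] PreExtrap T lam :=
  ((toPre T lam : X →ₗ[𝕜] PreExtrap T lam) ∘ₗ (T.op t : X →ₗ[𝕜] X) ∘ₗ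
      ((toPre T lam).symm : PreExtrap T lam →ₗ[𝕜] X)).mkContinuous ‖T.op t‖ fun x => by
    change ‖T.resolvent lam (T.op t ((toPre T lam).symm x))‖ ≤
      ‖T.op t‖ * ‖T.resolvent lam ((toPre T lam).symm x)‖
    rw [T.resolvent_comm]
    exact (T.op t).le_opNorm _

/-- The extension `T₋₁(t)` of `T(t)` to a bounded operator on `X₋₁`. -/
def extrapOp (t : ℝ≥0) : Extrap T lam →L[𝕜] Extrap T lam :=
  (preOp T lam t).completion

end C0Semigroup

/-! Young functions and Orlicz spaces -/

/-- `Φ` is a Young function: `Φ(t) = ∫₀ᵗ φ(s) ds` with `φ : [0,∞) → ℝ` right-continuous and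
nondecreasing, `φ(0) = 0`, `φ(s) > 0` for `s > 0`, and `φ(s) → ∞` as `s → ∞`. -/
def IsYoung (Φ : ℝ≥0 → ℝ≥0) : Prop :=
  ∃ φ : ℝ → ℝ,
    (∀ s, 0 ≤ s → ContinuousWithinAt φ (Ici s) s) ∧
    MonotoneOn φ (Ici 0) ∧
    φ 0 = 0 ∧
    (∀ s, 0 < s → 0 < φ s) ∧
    Tendsto φ atTop atTop ∧
    ∀ t : ℝ≥0, (Φ t : ℝ) = ∫ s in (0 : ℝ)..t, φ s

section Orlicz

variable {U : Type*} [NormedAddCommGroup U]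

/-- Lebesgue measure on the interval `(0,t)`. -/
def intervalMeasure (t : ℝ≥0) : Measure ℝ := volume.restrict (Ioo (0 : ℝ) t)

/-- `∫₀ᵗ Φ(‖u(s)‖ / k) ds ∈ [0,∞]`. -/
def modular (Φ : ℝ≥0 → ℝ≥0) (t k : ℝ≥0) (u : ℝ → U) : ℝ≥0∞ :=
  ∫⁻ s, (Φ (k⁻¹ * ‖u s‖₊) : ℝ≥0∞) ∂(intervalMeasure t)

/-- `u` represents an element of the Orlicz space `L_Φ(0,t;U)`. -/
def MemOrlicz (Φ : ℝ≥0 → ℝ≥0) (t : ℝ≥0) (u : ℝ → U) : Prop :=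
  AEStronglyMeasurable u (intervalMeasure t) ∧ ∃ k : ℝ≥0, 0 < k ∧ modular Φ t k u < ∞

/-- The Luxemburg norm of `u` in `L_Φ(0,t;U)`. -/
def luxemburgNorm (Φ : ℝ≥0 → ℝ≥0) (t : ℝ≥0) (u : ℝ → U) : ℝ≥0 :=
  sInf {k : ℝ≥0 | 0 < k ∧ modular Φ t k u ≤ 1}

/-- `u` represents an element of `E_Φ(0,t;U)`, the closure of `L^∞(0,t;U)` in `L_Φ(0,t;U)`
with respect to the Luxemburg norm. -/
def MemE (Φ : ℝ≥0 → ℝ≥0) (t : ℝ≥0) (u : ℝ → U) : Prop :=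
  MemOrlicz Φ t u ∧ ∀ ε : ℝ≥0, 0 < ε →
    ∃ v : ℝ → U, MemLp v ∞ (intervalMeasure t) ∧ luxemburgNorm Φ t (u - v) < ε

end Orlicz

/-! Comparison functions -/

/-- The class `𝒦`. -/
def ClassK : Set (ℝ≥0 → ℝ≥0) := {m | m 0 = 0 ∧ Continuous m ∧ StrictMono m}

/-- The class `𝒦_∞`. -/
def ClassKInf : Set (ℝ≥0 → ℝ≥0) := {θ | θ ∈ ClassK ∧ Tendsto θ atTop atTop}

/-- The class `ℒ`. -/
def ClassL : Set (ℝ≥0 → ℝ≥0) := {γ | Continuous γ ∧ StrictAnti γ ∧ Tendsto γ atTop (𝓝 0)}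

/-! The linear system `x' = A x + B u`, `x(0) = x₀`, with `A` the generator of `T` -/

section System

variable {𝕜 : Type*} [RCLike 𝕜] {X : Type*} [NormedAddCommGroup X] [NormedSpace 𝕜 X]
  {U : Type*} [NormedAddCommGroup U] [NormedSpace 𝕜 U]
  (T : C0Semigroup 𝕜 X) {lam : resolventSet T.generator} (B : U →L[𝕜] T.Extrap lam)

/-- `∫₀ᵗ T₋₁(s) B u(s) ds ∈ X₋₁`.  The inputs used below are Bochner integrable on `(0,t)`, and
then so is the integrand. -/
def inputMap (t : ℝ≥0) (u : ℝ → U) : T.Extrap lam :=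
  ∫ s, T.extrapOp lam s.toNNReal (B (u s)) ∂(intervalMeasure t)

/-- The mild solution `x(t) = T(t) x₀ + ∫₀ᵗ T₋₁(t - s) B u(s) ds`, an element of `X₋₁`. -/
def mildSolution (x₀ : X) (u : ℝ → U) (t : ℝ≥0) : T.Extrap lam :=
  T.embed lam (T.op t x₀) +
    ∫ s, T.extrapOp lam (t - s : ℝ).toNNReal (B (u s)) ∂(intervalMeasure t)

/-- (Finite-time) `E_Φ`-admissibility. -/
def IsAdmissible (Φ : ℝ≥0 → ℝ≥0) : Prop :=
  ∀ t : ℝ≥0, 0 < t → ∀ u : ℝ → U, MemE Φ t u → ∃ x : X, T.embed lam x = inputMap T B t u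

/-- Infinite-time `E_Φ`-admissibility: the constants in
`‖∫₀ᵗ T₋₁(s) B u(s) ds‖ ≤ c(t) ‖u‖` can be chosen independently of `t`. -/
def IsInfTimeAdmissible (Φ : ℝ≥0 → ℝ≥0) : Prop :=
  IsAdmissible T B Φ ∧ ∃ c : ℝ≥0, ∀ t : ℝ≥0, 0 < t → ∀ u : ℝ → U, MemE Φ t u →
    ∀ x : X, T.embed lam x = inputMap T B t u → ‖x‖₊ ≤ c * luxemburgNorm Φ t u

/-- The system is `E_Φ`-sISS. -/
def IsSISS (Φ : ℝ≥0 → ℝ≥0) : Prop :=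
  ∃ m ∈ ClassK, ∃ β : X → ℝ≥0 → ℝ≥0, (∀ x, x ≠ 0 → β x ∈ ClassL) ∧
    ∀ (t : ℝ≥0) (x₀ : X) (u : ℝ → U), MemE Φ t u →
      ∃ x : X, T.embed lam x = mildSolution T B x₀ u t ∧
        ‖x‖₊ ≤ β x₀ t + m (luxemburgNorm Φ t u)

/-- The system is siISS, and the function `μ` in the estimate can be taken to be `m`.  The
integral is finite for essentially bounded `u` and `m ∈ 𝒦`. -/
def IsSIISSWith (m : ℝ≥0 → ℝ≥0) : Prop :=
  m ∈ ClassK ∧ ∃ θ ∈ ClassKInf, ∃ β : X → ℝ≥0 → ℝ≥0, (∀ x, x ≠ 0 → β x ∈ ClassL) ∧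
    ∀ (t : ℝ≥0) (x₀ : X) (u : ℝ → U), MemLp u ∞ (intervalMeasure t) →
      ∃ x : X, T.embed lam x = mildSolution T B x₀ u t ∧
        ‖x‖₊ ≤ β x₀ t + θ (∫⁻ s, (m ‖u s‖₊ : ℝ≥0∞) ∂(intervalMeasure t)).toNNReal

/-- The system is siISS (that is, strongly integral input-to-state stable with respect to
`L^∞`). -/
def IsSIISS : Prop := ∃ m : ℝ≥0 → ℝ≥0, IsSIISSWith T B m

end System

end

end LinSys

/-! The siISS estimate is nonlinear in the input, whereas the input map is linear. Comparing the two
turns it into a norm bound. Fix one state x₀ ≠ 0. Subtracting T(t)x₀, which is itself bounded by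
β(x₀,t), leaves for bounded u the estimate ‖∫₀ᵗ T₋₁(s)Bu(s) ds‖ ≤ C + θ(∫₀ᵗ m(‖u‖)) with C =
2β(x₀,0) independent of t (`IsSIISSWith.exists_inputMap_le`).

Suppose m ≤ a + Φ with Φ a Young function. If the modular of v/k is at most 1, then ∫₀ᵗ m(‖v/k‖) ≤
at + 1. The estimate for v/k and homogeneity give the bound K·k with K = C + θ(at + 1), and the
infimum over k gives K‖v‖_Φ (`IsSIISSWith.exists_le_mul_luxemburgNorm`). This passes to E_Φ by
completeness of X; the limit is identified in X₋₁ because L_Φ embeds into L¹, on which the input map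
is continuous into X₋₁ (`exists_state_of_memE`).

Every m in 𝒦 is dominated in this way (`ClassK.exists_young`), which gives admissibility. If m is
itself Young, then a = 0 and K does not depend on t. This is infinite-time admissibility, and adding
T(t)x₀ gives sISS. -/

namespace LinSys

/-! ### The extrapolation space and joint continuity of the extrapolated semigroup. -/

namespace C0Semigroup

variable {𝕜 : Type*} [RCLike 𝕜] {X : Type*} [NormedAddCommGroup X] [NormedSpace 𝕜 X]
  (T : C0Semigroup 𝕜 X) (lam : resolventSet T.generator)

theorem embed_apply (x : X) :
    T.embed lam x =
      ((toPre T lam x : PreExtrap T lam) : UniformSpace.Completion (PreExtrap T lam)) :=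
  rfl

theorem embed_injective : Function.Injective (T.embed lam) := by
  intro x y h
  rw [embed_apply, embed_apply] at h
  exact (toPre T lam).injective (UniformSpace.Completion.coe_injective _ h)

theorem denseRange_embed : DenseRange (T.embed lam) := by
  have h : DenseRange ((↑) : PreExtrap T lam → UniformSpace.Completion (PreExtrap T lam)) :=
    UniformSpace.Completion.denseRange_coe
  have : range (T.embed lam) =
      range ((↑) : PreExtrap T lam → UniformSpace.Completion (PreExtrap T lam)) :=
    (toPre T lam).surjective.range_comp _
  unfold DenseRange
  rw [this]
  exact h

theorem extrapOp_embed (t : ℝ≥0) (x : X) :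
    T.extrapOp lam t (T.embed lam x) = T.embed lam (T.op t x) :=
  ContinuousLinearMap.completion_apply_coe (preOp T lam t) (toPre T lam x)

/-- On the dense copy of X the bound holds because T(t) commutes with the resolvent that defines the
norm. -/
theorem norm_extrapOp_apply_le (t : ℝ≥0) (z : T.Extrap lam) :
    ‖T.extrapOp lam t z‖ ≤ ‖T.op t‖ * ‖z‖ := by
  refine (T.denseRange_embed lam).induction_on z ?_ fun x => ?_
  · exact isClosed_le (T.extrapOp lam t).continuous.norm (continuous_const.mul continuous_norm)
  · rw [extrapOp_embed]
    have e (x : X) : ‖T.embed lam x‖ = ‖T.resolvent lam x‖ :=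
      (UniformSpace.Completion.norm_coe (toPre T lam x)).trans (norm_toPre T lam x)
    rw [e, e, resolvent_comm]
    exact (T.op t).le_opNorm _

theorem exists_norm_op_le [CompleteSpace X] (t : ℝ≥0) :
    ∃ M : ℝ, 0 ≤ M ∧ ∀ s ≤ t, ‖T.op s‖ ≤ M := by
  obtain ⟨M, hM⟩ := banach_steinhaus (g := fun s : Icc (0 : ℝ≥0) t => T.op s) fun x => by
    obtain ⟨C, hC⟩ := isCompact_Icc.exists_bound_of_continuousOn
      (s := Icc (0 : ℝ≥0) t) (T.continuous_orbit x).continuousOn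
    exact ⟨C, fun s => hC s s.2⟩
  exact ⟨M, (norm_nonneg _).trans (hM ⟨0, by simp⟩), fun s hs => hM ⟨s, zero_le, hs⟩⟩

theorem continuous_extrapOp_apply [CompleteSpace X] (z : T.Extrap lam) :
    Continuous fun s => T.extrapOp lam s z := by
  rw [continuous_iff_continuousAt]
  intro s₀
  obtain ⟨M, hM0, hM⟩ := T.exists_norm_op_le (s₀ + 1)
  rw [Metric.continuousAt_iff']
  intro ε hε
  obtain ⟨x, hx⟩ := (T.denseRange_embed lam).exists_dist_lt z
    (show 0 < ε / (3 * (M + 1)) by positivity)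
  have h1 : ContinuousAt (fun s => T.embed lam (T.op s x)) s₀ :=
    ((T.embed lam).continuous.comp (T.continuous_orbit x)).continuousAt
  have hb (s : ℝ≥0) (hs : s ≤ s₀ + 1) :
      dist (T.extrapOp lam s z) (T.embed lam (T.op s x)) < ε / 3 := by
    rw [← extrapOp_embed, dist_eq_norm, ← map_sub]
    rw [dist_eq_norm] at hx
    calc _ ≤ ‖T.op s‖ * ‖z - T.embed lam x‖ := T.norm_extrapOp_apply_le lam s _
      _ ≤ M * ‖z - T.embed lam x‖ := by gcongr; exact hM s hs
      _ ≤ M * (ε / (3 * (M + 1))) := by gcongr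
      _ < (M + 1) * (ε / (3 * (M + 1))) := by gcongr; linarith
      _ = ε / 3 := by field_simp
  filter_upwards [Metric.continuousAt_iff'.1 h1 (ε / 3) (by positivity),
    Iic_mem_nhds (show s₀ < s₀ + 1 by simp)] with s hs hs1
  have h2 := hb s hs1
  have h3 := hb s₀ (by simp)
  rw [dist_comm] at h3
  linarith [dist_triangle4 (T.extrapOp lam s z) (T.embed lam (T.op s x))
    (T.embed lam (T.op s₀ x)) (T.extrapOp lam s₀ z)]

/-- Strong continuity together with local boundedness of ‖T(s)‖. Joint continuity is what makes s ↦
T₋₁(s)Bu(s) strongly measurable. -/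
theorem continuous_extrapOp_uncurry [CompleteSpace X] :
    Continuous fun p : ℝ≥0 × T.Extrap lam => T.extrapOp lam p.1 p.2 := by
  rw [continuous_iff_continuousAt]
  rintro ⟨s₀, z₀⟩
  obtain ⟨M, -, hM⟩ := T.exists_norm_op_le (s₀ + 1)
  have h1 : Tendsto (fun p : ℝ≥0 × T.Extrap lam => M * ‖p.2 - z₀‖) (𝓝 (s₀, z₀)) (𝓝 0) := by
    have : Continuous fun p : ℝ≥0 × T.Extrap lam => M * ‖p.2 - z₀‖ := by fun_prop
    simpa using this.tendsto (s₀, z₀)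
  have h2 : Tendsto (fun p : ℝ≥0 × T.Extrap lam => T.extrapOp lam p.1 z₀) (𝓝 (s₀, z₀))
      (𝓝 (T.extrapOp lam s₀ z₀)) :=
    ((T.continuous_extrapOp_apply lam z₀).comp continuous_fst).tendsto (s₀, z₀)
  have h3 : Tendsto (fun p : ℝ≥0 × T.Extrap lam => T.extrapOp lam p.1 (p.2 - z₀))
      (𝓝 (s₀, z₀)) (𝓝 0) := by
    refine squeeze_zero_norm' ?_ h1
    have : ∀ᶠ p : ℝ≥0 × T.Extrap lam in 𝓝 (s₀, z₀), p.1 ≤ s₀ + 1 :=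
      continuous_fst.continuousAt.eventually (Iic_mem_nhds (show s₀ < s₀ + 1 by simp))
    filter_upwards [this] with p hp
    refine (T.norm_extrapOp_apply_le lam _ _).trans ?_
    gcongr
    exact hM _ hp
  refine (by simpa using h3.add h2 : Tendsto _ _ _)

end C0Semigroup

/-! ### Lebesgue measure on (0,t) and its reflection s ↦ t - s. -/

section

instance (t : ℝ≥0) : IsFiniteMeasure (intervalMeasure t) := by
  unfold intervalMeasure
  infer_instance

theorem intervalMeasure_univ (t : ℝ≥0) : intervalMeasure t univ = t := by
  simp [intervalMeasure]

theorem measurePreserving_intervalMeasure (t : ℝ≥0) :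
    MeasurePreserving (fun s : ℝ => t - s) (intervalMeasure t) (intervalMeasure t) := by
  have h := (Measure.measurePreserving_sub_left (volume : Measure ℝ) (t : ℝ)).restrict_preimage
    (s := Ioo (0 : ℝ) t) measurableSet_Ioo
  simpa [intervalMeasure] using h

theorem measurableEmbedding_const_sub (t : ℝ) : MeasurableEmbedding fun s : ℝ => t - s :=
  (MeasurableEquiv.subLeft t).measurableEmbedding

end

/-! ### The input map as a continuous linear map from L¹ to X₋₁. -/

section System

variable {𝕜 : Type*} [RCLike 𝕜] {X : Type*} [NormedAddCommGroup X] [NormedSpace 𝕜 X]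
  {U : Type*} [NormedAddCommGroup U] [NormedSpace 𝕜 U]
  (T : C0Semigroup 𝕜 X) {lam : resolventSet T.generator} (B : U →L[𝕜] T.Extrap lam)

theorem mildSolution_eq (x₀ : X) (u : ℝ → U) (t : ℝ≥0) :
    mildSolution T B x₀ u t =
      T.embed lam (T.op t x₀) + inputMap T B t (fun s => u (t - s)) := by
  unfold mildSolution inputMap
  congr 1
  rw [← (measurePreserving_intervalMeasure t).integral_comp (measurableEmbedding_const_sub t)]
  simp

/-- Only real factors are needed, for normalising inputs. They are read in 𝕜 because U carries only
its 𝕜-structure, while the integral uses the restricted real structure of X₋₁. -/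
theorem inputMap_smul (t : ℝ≥0) (c : ℝ) (u : ℝ → U) :
    inputMap T B t ((c : 𝕜) • u) = (c : 𝕜) • inputMap T B t u := by
  have h (z : T.Extrap lam) : (c : 𝕜) • z = c • z := rfl
  simp only [inputMap, Pi.smul_apply, map_smul]
  simp only [h]
  exact integral_smul c fun s : ℝ => T.extrapOp lam s.toNNReal (B (u s))

variable [CompleteSpace X]

theorem aestronglyMeasurable_extrapOp {u : ℝ → U} {t : ℝ≥0}
    (hu : AEStronglyMeasurable u (intervalMeasure t)) :
    AEStronglyMeasurable (fun s : ℝ => T.extrapOp lam s.toNNReal (B (u s)))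
      (intervalMeasure t) := by
  have h1 : AEStronglyMeasurable (fun s : ℝ => s.toNNReal) (intervalMeasure t) :=
    continuous_real_toNNReal.aestronglyMeasurable
  have h2 : AEStronglyMeasurable (fun s : ℝ => B (u s)) (intervalMeasure t) :=
    B.continuous.comp_aestronglyMeasurable hu
  have h3 : AEStronglyMeasurable (fun s : ℝ => (s.toNNReal, B (u s))) (intervalMeasure t) :=
    h1.prodMk h2
  have h4 := T.continuous_extrapOp_uncurry lam
  generalize hF : (fun p : ℝ≥0 × T.Extrap lam => T.extrapOp lam p.1 p.2) = F at h4
  have h5 : (fun s : ℝ => T.extrapOp lam s.toNNReal (B (u s))) =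
      fun s : ℝ => F (s.toNNReal, B (u s)) := by
    rw [← hF]
  rw [h5]
  exact h4.comp_aestronglyMeasurable h3

theorem exists_norm_extrapOp_le (t : ℝ≥0) : ∃ M : ℝ≥0, ∀ u : ℝ → U,
    ∀ᵐ s ∂(intervalMeasure t), ‖T.extrapOp lam s.toNNReal (B (u s))‖ ≤ M * ‖u s‖ := by
  obtain ⟨M, hM0, hM⟩ := T.exists_norm_op_le t
  lift M to ℝ≥0 using hM0
  refine ⟨M * ‖B‖₊, fun u => ?_⟩
  filter_upwards [ae_restrict_mem measurableSet_Ioo] with s hs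
  refine (T.norm_extrapOp_apply_le lam _ _).trans ?_
  rw [NNReal.coe_mul, coe_nnnorm, mul_assoc]
  refine mul_le_mul (hM _ ?_) (B.le_opNorm _) (norm_nonneg _) M.2
  exact Real.toNNReal_le_iff_le_coe.2 hs.2.le

theorem integrable_extrapOp {u : ℝ → U} {t : ℝ≥0} (hu : Integrable u (intervalMeasure t)) :
    Integrable (fun s : ℝ => T.extrapOp lam s.toNNReal (B (u s))) (intervalMeasure t) := by
  obtain ⟨M, hM⟩ := exists_norm_extrapOp_le T B t
  exact (hu.norm.const_mul (M : ℝ)).mono' (aestronglyMeasurable_extrapOp T B hu.1) (hM u)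

theorem inputMap_sub {u v : ℝ → U} {t : ℝ≥0} (hu : Integrable u (intervalMeasure t))
    (hv : Integrable v (intervalMeasure t)) :
    inputMap T B t (u - v) = inputMap T B t u - inputMap T B t v := by
  simp only [inputMap, Pi.sub_apply, map_sub]
  exact integral_sub (integrable_extrapOp T B hu) (integrable_extrapOp T B hv)

theorem exists_norm_inputMap_le (t : ℝ≥0) : ∃ M : ℝ≥0, ∀ u : ℝ → U,
    Integrable u (intervalMeasure t) →
    ‖inputMap T B t u‖ ≤ M * ∫ s, ‖u s‖ ∂(intervalMeasure t) := by
  obtain ⟨M, hM⟩ := exists_norm_extrapOp_le T B t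
  refine ⟨M, fun u hu => ?_⟩
  rw [← integral_const_mul]
  exact norm_integral_le_of_norm_le (hu.norm.const_mul (M : ℝ)) (hM u)

end System

/-! ### Convexity and growth of Young functions. -/

namespace IsYoung

variable {Φ : ℝ≥0 → ℝ≥0}

/-- Since φ is monotone, φ(a) bounds the integrand from below to the right of a and from above to
the left. Monotonicity, convexity and linear growth of Φ all follow from this inequality. -/
theorem exists_subgradient (h : IsYoung Φ) : ∃ φ : ℝ≥0 → ℝ≥0, (∀ s, 0 < s → 0 < φ s) ∧
    ∀ a b : ℝ≥0, (Φ a : ℝ) + φ a * ((b : ℝ) - a) ≤ Φ b := by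
  obtain ⟨φ, -, hm, h0, hpos, -, hΦ⟩ := h
  have hn (s : ℝ≥0) : 0 ≤ φ s := by
    rw [← h0]
    exact hm self_mem_Ici s.2 s.2
  refine ⟨fun s => (φ s).toNNReal, fun s hs => Real.toNNReal_pos.2 (hpos s hs), fun a b => ?_⟩
  rw [Real.coe_toNNReal _ (hn a)]
  have hi (x y : ℝ≥0) : IntervalIntegrable φ volume x y := by
    refine (hm.mono fun z hz => ?_).intervalIntegrable
    exact (le_min x.2 y.2).trans hz.1
  have hs : (Φ b : ℝ) - Φ a = ∫ s in (a : ℝ)..b, φ s := by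
    rw [hΦ, hΦ]
    exact intervalIntegral.integral_interval_sub_left (hi 0 b) (hi 0 a)
  suffices φ a * ((b : ℝ) - a) ≤ ∫ s in (a : ℝ)..b, φ s by linarith
  rcases le_total a b with hab | hab
  · have := intervalIntegral.integral_mono_on (NNReal.coe_le_coe.2 hab)
      (intervalIntegrable_const (c := φ a)) (hi a b)
      fun x hx => hm a.2 (a.2.trans hx.1) hx.1
    simpa [mul_comm] using this
  · have := intervalIntegral.integral_mono_on (NNReal.coe_le_coe.2 hab)
      (hi b a) (intervalIntegrable_const (c := φ a))
      fun x hx => hm (b.2.trans hx.1) a.2 hx.2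
    rw [intervalIntegral.integral_symm]
    simp only [intervalIntegral.integral_const, smul_eq_mul] at this
    linarith

theorem zero (h : IsYoung Φ) : Φ 0 = 0 := by
  obtain ⟨φ, -, -, -, -, -, hΦ⟩ := h
  simpa using hΦ 0

theorem monotone (h : IsYoung Φ) : Monotone Φ := by
  obtain ⟨φ, -, hφ⟩ := h.exists_subgradient
  intro a b hab
  have h1 := hφ a b
  have h2 : 0 ≤ (φ a : ℝ) * ((b : ℝ) - a) :=
    mul_nonneg (φ a).2 (sub_nonneg.2 (NNReal.coe_le_coe.2 hab))
  exact NNReal.coe_le_coe.1 (by linarith)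

theorem convex (h : IsYoung Φ) {c d : ℝ≥0} (hcd : c + d = 1) (x y : ℝ≥0) :
    Φ (c * x + d * y) ≤ c * Φ x + d * Φ y := by
  obtain ⟨φ, -, hφ⟩ := h.exists_subgradient
  rw [← NNReal.coe_le_coe]
  -- In the weighted sum of the two subgradient inequalities at the mean point, the linear terms
  -- cancel.
  have h1 := mul_le_mul_of_nonneg_left (hφ (c * x + d * y) x) c.coe_nonneg
  have h2 := mul_le_mul_of_nonneg_left (hφ (c * x + d * y) y) d.coe_nonneg
  have hd : (d : ℝ) = 1 - c := by rw [← NNReal.coe_one, ← hcd]; simp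
  push_cast at *
  rw [hd] at h1 h2 ⊢
  linarith

theorem map_mul_le (h : IsYoung Φ) {c : ℝ≥0} (hc : c ≤ 1) (x : ℝ≥0) : Φ (c * x) ≤ c * Φ x := by
  simpa [h.zero] using h.convex (add_tsub_cancel_of_le hc) x 0

/-- The subgradient at 1 has positive slope. This growth yields the embedding of L_Φ into L¹. -/
theorem exists_le_one_add (h : IsYoung Φ) : ∃ a : ℝ≥0, ∀ x, x ≤ 1 + a * Φ x := by
  obtain ⟨φ, hpos, hφ⟩ := h.exists_subgradient
  have h1 := hpos 1 one_pos
  refine ⟨(φ 1)⁻¹, fun x => ?_⟩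
  have h2 : (φ 1 : ℝ) * (x - 1) ≤ Φ x := by
    have := hφ 1 x
    have := (Φ 1).2
    push_cast at *
    linarith
  rw [← NNReal.coe_le_coe]
  push_cast
  have h3 : (0 : ℝ) < φ 1 := h1
  rw [← sub_le_iff_le_add', ← div_eq_inv_mul, le_div_iff₀ h3]
  linarith

end IsYoung

/-! ### Orlicz spaces: the Luxemburg norm and the embedding into L¹. -/

section Orlicz

variable {U : Type*} [NormedAddCommGroup U] {Φ : ℝ≥0 → ℝ≥0} {t : ℝ≥0} {u v : ℝ → U}

theorem luxemburgNorm_le {k : ℝ≥0} (hk : 0 < k) (h : modular Φ t k u ≤ 1) :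
    luxemburgNorm Φ t u ≤ k :=
  csInf_le (OrderBot.bddBelow _) ⟨hk, h⟩

theorem modular_anti (hΦ : Monotone Φ) {k l : ℝ≥0} (hk : 0 < k) (hkl : k ≤ l) :
    modular Φ t l u ≤ modular Φ t k u := by
  refine lintegral_mono fun s => ?_
  refine ENNReal.coe_le_coe.2 (hΦ ?_)
  gcongr

theorem modular_neg (k : ℝ≥0) : modular Φ t k (-u) = modular Φ t k u := by
  simp [modular]

theorem luxemburgNorm_neg : luxemburgNorm Φ t (-u) = luxemburgNorm Φ t u := by
  simp [luxemburgNorm, modular_neg]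

theorem modular_comp_sub (k : ℝ≥0) :
    modular Φ t k (fun s => u (t - s)) = modular Φ t k u :=
  (measurePreserving_intervalMeasure t).lintegral_comp_emb (measurableEmbedding_const_sub t)
    fun s => (Φ (k⁻¹ * ‖u s‖₊) : ℝ≥0∞)

theorem luxemburgNorm_comp_sub :
    luxemburgNorm Φ t (fun s => u (t - s)) = luxemburgNorm Φ t u := by
  simp only [luxemburgNorm, modular_comp_sub]

theorem _root_.MeasureTheory.MemLp.comp_sub (h : MemLp v ∞ (intervalMeasure t)) :
    MemLp (fun s => v (t - s)) ∞ (intervalMeasure t) :=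
  h.comp_measurePreserving (measurePreserving_intervalMeasure t)

theorem MemE.comp_sub (h : MemE Φ t u) : MemE Φ t fun s => u (t - s) := by
  obtain ⟨⟨hm, k, hk, hk'⟩, ha⟩ := h
  refine ⟨⟨hm.comp_measurePreserving (measurePreserving_intervalMeasure t), k, hk, ?_⟩,
    fun ε hε => ?_⟩
  · rwa [modular_comp_sub]
  · obtain ⟨v, hv, hv'⟩ := ha ε hε
    exact ⟨_, hv.comp_sub, by rwa [← luxemburgNorm_comp_sub] at hv'⟩

theorem MemOrlicz.exists_modular_le_one (hΦ : IsYoung Φ) (h : MemOrlicz Φ t u) :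
    ∃ k : ℝ≥0, 0 < k ∧ modular Φ t k u ≤ 1 := by
  obtain ⟨-, k, hk, hfin⟩ := h
  lift modular Φ t k u to ℝ≥0 using hfin.ne with m hm
  have hc : 0 < (m + 1)⁻¹ := by positivity
  -- By convexity and Φ(0) = 0, dividing the argument by m + 1 divides the modular by at least m +
  -- 1, so m becomes at most m/(m + 1).
  refine ⟨k * (m + 1), by positivity, ?_⟩
  calc modular Φ t (k * (m + 1)) u
      ≤ ∫⁻ s, ((m + 1)⁻¹ : ℝ≥0) * (Φ (k⁻¹ * ‖u s‖₊) : ℝ≥0∞) ∂(intervalMeasure t) := by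
        refine lintegral_mono fun s => ?_
        rw [mul_inv_rev, mul_assoc, ← ENNReal.coe_mul]
        refine ENNReal.coe_le_coe.2 ?_
        exact hΦ.map_mul_le (inv_le_one_of_one_le₀ le_add_self) _
    _ = ((m + 1)⁻¹ : ℝ≥0) * modular Φ t k u := lintegral_const_mul' _ _ ENNReal.coe_ne_top
    _ ≤ 1 := by
        rw [← hm]
        norm_cast
        rw [inv_mul_le_iff₀ (by positivity)]
        simp

theorem MemOrlicz.modular_le_one (hΦ : IsYoung Φ) (h : MemOrlicz Φ t u) {k : ℝ≥0}
    (hk : luxemburgNorm Φ t u < k) : modular Φ t k u ≤ 1 := by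
  obtain ⟨l, ⟨hl0, hl⟩, hlk⟩ := exists_lt_of_csInf_lt (h.exists_modular_le_one hΦ) hk
  exact (modular_anti hΦ.monotone hl0 hlk.le).trans hl

/-- Passes to the infimum over k. Membership in L_Φ guarantees that the infimum is not over the
empty set, where it would take the default value 0. -/
theorem MemOrlicz.le_mul_luxemburgNorm (hΦ : IsYoung Φ) (h : MemOrlicz Φ t u) {a C : ℝ≥0}
    (ha : ∀ k, 0 < k → modular Φ t k u ≤ 1 → a ≤ C * k) : a ≤ C * luxemburgNorm Φ t u := by
  rcases eq_zero_or_pos C with rfl | hC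
  · obtain ⟨k, hk, hk'⟩ := h.exists_modular_le_one hΦ
    simpa using ha k hk hk'
  · rw [← div_le_iff₀' hC]
    refine le_csInf (h.exists_modular_le_one hΦ) fun k hk => ?_
    rw [div_le_iff₀' hC]
    exact ha k hk.1 hk.2

/-- Writes (u + v)/(k + l) as the convex combination of u/k and v/l with weights k/(k + l) and l/(k
+ l). -/
theorem modular_add_le (hΦ : IsYoung Φ) (hu : AEStronglyMeasurable u (intervalMeasure t))
    {k l : ℝ≥0} (hk : 0 < k) (hl : 0 < l) :
    modular Φ t (k + l) (u + v) ≤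
      (k / (k + l) : ℝ≥0) * modular Φ t k u + (l / (k + l) : ℝ≥0) * modular Φ t l v := by
  have hkl : k / (k + l) + l / (k + l) = 1 := by
    rw [← add_div, div_self (by positivity)]
  unfold modular
  rw [← lintegral_const_mul' _ _ ENNReal.coe_ne_top,
    ← lintegral_const_mul' _ _ ENNReal.coe_ne_top, ← lintegral_add_left']
  · refine lintegral_mono fun s => ?_
    rw [← ENNReal.coe_mul, ← ENNReal.coe_mul, ← ENNReal.coe_add]
    refine ENNReal.coe_le_coe.2 ?_
    refine le_trans (hΦ.monotone ?_) (hΦ.convex hkl _ _)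
    calc (k + l)⁻¹ * ‖(u + v) s‖₊ ≤ (k + l)⁻¹ * (‖u s‖₊ + ‖v s‖₊) := by
          gcongr
          exact nnnorm_add_le _ _
      _ = k / (k + l) * (k⁻¹ * ‖u s‖₊) + l / (k + l) * (l⁻¹ * ‖v s‖₊) := by
          field_simp
  · refine AEMeasurable.const_mul ?_ _
    exact (hΦ.monotone.measurable.comp_aemeasurable
      (hu.nnnorm.aemeasurable.const_mul _)).coe_nnreal_ennreal

theorem MemOrlicz.add (hΦ : IsYoung Φ) (hu : MemOrlicz Φ t u) (hv : MemOrlicz Φ t v) :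
    MemOrlicz Φ t (u + v) := by
  obtain ⟨k, hk, hk'⟩ := hu.2
  obtain ⟨l, hl, hl'⟩ := hv.2
  refine ⟨hu.1.add hv.1, k + l, by positivity, (modular_add_le hΦ hu.1 hk hl).trans_lt ?_⟩
  exact ENNReal.add_lt_top.2 ⟨ENNReal.mul_lt_top ENNReal.coe_lt_top hk',
    ENNReal.mul_lt_top ENNReal.coe_lt_top hl'⟩

theorem MemOrlicz.neg (hu : MemOrlicz Φ t u) : MemOrlicz Φ t (-u) :=
  ⟨hu.1.neg, by simpa only [modular_neg] using hu.2⟩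

theorem MemOrlicz.sub (hΦ : IsYoung Φ) (hu : MemOrlicz Φ t u) (hv : MemOrlicz Φ t v) :
    MemOrlicz Φ t (u - v) := by
  rw [sub_eq_add_neg]
  exact hu.add hΦ hv.neg

theorem luxemburgNorm_add_le (hΦ : IsYoung Φ) (hu : MemOrlicz Φ t u) (hv : MemOrlicz Φ t v) :
    luxemburgNorm Φ t (u + v) ≤ luxemburgNorm Φ t u + luxemburgNorm Φ t v := by
  refine le_of_forall_pos_le_add fun ε hε => ?_
  -- The slack makes each constant exceed the norm strictly, so that the modular is at most 1
  -- without knowing that the infimum is attained.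
  have hε' : 0 < ε / 2 := by positivity
  have hk := hu.modular_le_one hΦ (lt_add_of_pos_right _ hε')
  have hl := hv.modular_le_one hΦ (lt_add_of_pos_right _ hε')
  set k := luxemburgNorm Φ t u + ε / 2
  set l := luxemburgNorm Φ t v + ε / 2
  have hk0 : 0 < k := by positivity
  have hl0 : 0 < l := by positivity
  have h1 : modular Φ t (k + l) (u + v) ≤ 1 := by
    refine (modular_add_le hΦ hu.1 hk0 hl0).trans ?_
    calc _ ≤ ((k / (k + l) : ℝ≥0) : ℝ≥0∞) * 1 + ((l / (k + l) : ℝ≥0) : ℝ≥0∞) * 1 := by gcongr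
      _ = ((k / (k + l) + l / (k + l) : ℝ≥0) : ℝ≥0∞) := by push_cast; simp
      _ = 1 := by
        rw [← add_div, div_self (by positivity), ENNReal.coe_one]
  refine (luxemburgNorm_le (by positivity) h1).trans_eq ?_
  simp only [k, l]
  rw [add_add_add_comm, add_halves]

theorem luxemburgNorm_sub_le (hΦ : IsYoung Φ) (hu : MemOrlicz Φ t u) (hv : MemOrlicz Φ t v) :
    luxemburgNorm Φ t (u - v) ≤ luxemburgNorm Φ t u + luxemburgNorm Φ t v := by
  rw [sub_eq_add_neg]
  refine (luxemburgNorm_add_le hΦ hu hv.neg).trans_eq ?_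
  rw [luxemburgNorm_neg]

theorem _root_.MeasureTheory.MemLp.memOrlicz (hΦ : IsYoung Φ)
    (hv : MemLp v ∞ (intervalMeasure t)) : MemOrlicz Φ t v := by
  refine ⟨hv.1, 1, one_pos, ?_⟩
  have hfin : eLpNormEssSup v (intervalMeasure t) ≠ ∞ := by
    simpa using hv.2.ne
  lift eLpNormEssSup v (intervalMeasure t) to ℝ≥0 using hfin with C hC
  refine (lintegral_mono_ae (g := fun _ => (Φ C : ℝ≥0∞)) ?_).trans_lt ?_
  · filter_upwards [ae_le_eLpNormEssSup (f := v) (μ := intervalMeasure t)] with s hs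
    refine ENNReal.coe_le_coe.2 (hΦ.monotone ?_)
    rw [inv_one, one_mul]
    rw [← hC] at hs
    exact ENNReal.coe_le_coe.1 hs
  · rw [lintegral_const]
    exact ENNReal.mul_lt_top ENNReal.coe_lt_top (measure_lt_top _ _)

theorem lintegral_nnnorm_le {a : ℝ≥0} (ha : ∀ x, x ≤ 1 + a * Φ x) {k : ℝ≥0} (hk : 0 < k)
    (h : modular Φ t k u ≤ 1) :
    ∫⁻ s, (‖u s‖₊ : ℝ≥0∞) ∂(intervalMeasure t) ≤ ((t + a) * k : ℝ≥0) := by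
  calc ∫⁻ s, (‖u s‖₊ : ℝ≥0∞) ∂(intervalMeasure t)
      ≤ ∫⁻ s, (k : ℝ≥0∞) * (1 + a * (Φ (k⁻¹ * ‖u s‖₊) : ℝ≥0∞)) ∂(intervalMeasure t) := by
        refine lintegral_mono fun s => ?_
        have := ha (k⁻¹ * ‖u s‖₊)
        rw [inv_mul_le_iff₀ hk, ← ENNReal.coe_le_coe] at this
        push_cast at this
        exact this
    _ = k * (t + a * modular Φ t k u) := by
        rw [lintegral_const_mul' _ _ ENNReal.coe_ne_top, lintegral_add_left measurable_const,
          lintegral_const_mul' _ _ ENNReal.coe_ne_top, lintegral_one, intervalMeasure_univ,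
          modular]
    _ ≤ k * (t + a * 1) := by gcongr
    _ = ((t + a) * k : ℝ≥0) := by push_cast; ring

theorem MemOrlicz.integrable (hΦ : IsYoung Φ) (h : MemOrlicz Φ t u) :
    Integrable u (intervalMeasure t) := by
  obtain ⟨a, ha⟩ := hΦ.exists_le_one_add
  obtain ⟨k, hk, hk'⟩ := h.exists_modular_le_one hΦ
  exact ⟨h.1, (lintegral_nnnorm_le ha hk hk').trans_lt ENNReal.coe_lt_top⟩

theorem exists_integral_norm_le (U : Type*) [NormedAddCommGroup U] (hΦ : IsYoung Φ) (t : ℝ≥0) :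
    ∃ C : ℝ≥0, ∀ u : ℝ → U, MemOrlicz Φ t u →
      ∫ s, ‖u s‖ ∂(intervalMeasure t) ≤ C * luxemburgNorm Φ t u := by
  obtain ⟨a, ha⟩ := hΦ.exists_le_one_add
  refine ⟨t + a, fun u h => ?_⟩
  have hint := (h.integrable hΦ).2
  rw [integral_norm_eq_lintegral_enorm h.1]
  have h1 := h.le_mul_luxemburgNorm hΦ (a := (∫⁻ s, ‖u s‖ₑ ∂(intervalMeasure t)).toNNReal)
    (C := t + a) fun k hk hk' =>
      ENNReal.toNNReal_mono ENNReal.coe_ne_top (lintegral_nnnorm_le ha hk hk')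
  exact_mod_cast h1

end Orlicz

/-! ### Domination of a class 𝒦 function by a Young function. -/

theorem ClassK.exists_young {m : ℝ≥0 → ℝ≥0} (hm : m ∈ ClassK) :
    ∃ Φ, IsYoung Φ ∧ ∀ x, m x ≤ m 1 + Φ x := by
  obtain ⟨-, hc, hs⟩ := hm
  -- The shift by 1 gives φ ≥ m(x) - m(1) on the unit interval [x - 1, x], so Φ(x) ≥ m(x) - m(1) for
  -- x ≥ 1. The summand s makes φ unbounded even if m is bounded.
  let φ : ℝ → ℝ := fun s => m (s.toNNReal + 1) - m 1 + s
  have hcont : Continuous φ := by fun_prop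
  have hmono : StrictMono φ := fun x y hxy => by
    have h1 : m (x.toNNReal + 1) ≤ m (y.toNNReal + 1) := by
      apply hs.monotone
      gcongr
    have h2 := NNReal.coe_le_coe.2 h1
    simp only [φ]
    linarith
  have h0 : φ 0 = 0 := by simp [φ]
  have hnn (s : ℝ) (h : 0 ≤ s) : 0 ≤ φ s := h0 ▸ hmono.monotone h
  have hint (a b : ℝ) : IntervalIntegrable φ volume a b := hcont.intervalIntegrable a b
  have hI (x : ℝ≥0) : 0 ≤ ∫ s in (0 : ℝ)..x, φ s :=
    intervalIntegral.integral_nonneg x.2 fun s hs => hnn s hs.1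
  refine ⟨fun x => (∫ s in (0 : ℝ)..x, φ s).toNNReal, ⟨φ,
    fun s _ => hcont.continuousWithinAt, hmono.monotone.monotoneOn _,
    h0, fun s hs => h0 ▸ hmono hs, ?_, fun x => Real.coe_toNNReal _ (hI x)⟩, fun x => ?_⟩
  · refine tendsto_atTop_mono' atTop ?_ tendsto_id
    filter_upwards [eventually_ge_atTop 0] with s _
    have : m 1 ≤ m (s.toNNReal + 1) := hs.monotone (by simp)
    have := NNReal.coe_le_coe.2 this
    simp only [φ, id]
    linarith
  · rcases le_total x 1 with hx | hx
    · exact (hs.monotone hx).trans (by simp)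
    rw [← NNReal.coe_le_coe, NNReal.coe_add, Real.coe_toNNReal _ (hI x)]
    have hx' : (1 : ℝ) ≤ x := hx
    rw [← intervalIntegral.integral_add_adjacent_intervals (hint 0 (x - 1)) (hint (x - 1) x)]
    have h1 : 0 ≤ ∫ s in (0 : ℝ)..(x - 1 : ℝ), φ s :=
      intervalIntegral.integral_nonneg (by linarith) fun s hs => hnn s hs.1
    have h2 : ∫ s in (x - 1 : ℝ)..x, ((m x : ℝ) - m 1) ≤ ∫ s in (x - 1 : ℝ)..x, φ s := by
      refine intervalIntegral.integral_mono_on (by linarith) intervalIntegrable_const (hint _ _)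
        fun s hs' => ?_
      have h3 : m x ≤ m (s.toNNReal + 1) := by
        apply hs.monotone
        rw [← NNReal.coe_le_coe]
        push_cast
        linarith [Real.le_coe_toNNReal s, hs'.1]
      have := NNReal.coe_le_coe.2 h3
      have := hs'.1
      simp only [φ]
      linarith
    simp at h2
    linarith

/-! ### From the siISS estimate to linear bounds, admissibility and sISS. -/

section System

variable {𝕜 : Type*} [RCLike 𝕜] {X : Type*} [NormedAddCommGroup X] [NormedSpace 𝕜 X]
  {U : Type*} [NormedAddCommGroup U] [NormedSpace 𝕜 U]
  {T : C0Semigroup 𝕜 X} {lam : resolventSet T.generator} {B : U →L[𝕜] T.Extrap lam}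

/-- The zero input contributes θ(0) = 0, so β alone dominates the free orbit. -/
theorem IsSIISSWith.exists_decay {m : ℝ≥0 → ℝ≥0} (h : IsSIISSWith T B m) :
    ∃ θ ∈ ClassKInf, ∃ β : X → ℝ≥0 → ℝ≥0, (∀ x, x ≠ 0 → β x ∈ ClassL) ∧
      (∀ x t, ‖T.op t x‖₊ ≤ β x t) ∧
      ∀ (t : ℝ≥0) (x₀ : X) (u : ℝ → U), MemLp u ∞ (intervalMeasure t) →
        ∃ x : X, T.embed lam x = mildSolution T B x₀ u t ∧
          ‖x‖₊ ≤ β x₀ t + θ (∫⁻ s, (m ‖u s‖₊ : ℝ≥0∞) ∂(intervalMeasure t)).toNNReal := by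
  obtain ⟨hm, θ, hθ, β, hβ, H⟩ := h
  refine ⟨θ, hθ, β, hβ, fun x₀ t => ?_, H⟩
  obtain ⟨x, hx, hx'⟩ := H t x₀ 0 MemLp.zero'
  have : mildSolution T B x₀ (0 : ℝ → U) t = T.embed lam (T.op t x₀) := by
    rw [mildSolution_eq]
    simp [inputMap]
  rw [this] at hx
  obtain rfl := T.embed_injective lam hx
  simpa [hm.1, hθ.1.1] using hx'

/-- The input-to-state map of a siISS system on bounded inputs, up to an additive constant. -/
theorem IsSIISSWith.exists_inputMap_le {m : ℝ≥0 → ℝ≥0} (h : IsSIISSWith T B m) :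
    ∃ C : ℝ≥0, ∃ θ : ℝ≥0 → ℝ≥0, Monotone θ ∧
      ∀ (t : ℝ≥0) (u : ℝ → U), MemLp u ∞ (intervalMeasure t) →
        ∃ x : X, T.embed lam x = inputMap T B t u ∧
          ‖x‖₊ ≤ C + θ (∫⁻ s, (m ‖u s‖₊ : ℝ≥0∞) ∂(intervalMeasure t)).toNNReal := by
  obtain ⟨θ, hθ, β, hβ, hT, H⟩ := h.exists_decay
  have key (x₀ : X) (t : ℝ≥0) (u : ℝ → U) (hu : MemLp u ∞ (intervalMeasure t)) :
      ∃ x : X, T.embed lam x = inputMap T B t u ∧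
        ‖x‖₊ ≤ β x₀ t + β x₀ t +
          θ (∫⁻ s, (m ‖u s‖₊ : ℝ≥0∞) ∂(intervalMeasure t)).toNNReal := by
    obtain ⟨x, hx, hx'⟩ := H t x₀ (fun s => u (t - s)) hu.comp_sub
    have e : ∫⁻ s, (m ‖u (t - s)‖₊ : ℝ≥0∞) ∂(intervalMeasure t) =
        ∫⁻ s, (m ‖u s‖₊ : ℝ≥0∞) ∂(intervalMeasure t) :=
      (measurePreserving_intervalMeasure t).lintegral_comp_emb
        (measurableEmbedding_const_sub t) fun s => (m ‖u s‖₊ : ℝ≥0∞)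
    rw [e] at hx'
    refine ⟨x - T.op t x₀, ?_, ?_⟩
    · rw [map_sub, hx, mildSolution_eq]
      simp
    · calc ‖x - T.op t x₀‖₊ ≤ ‖x‖₊ + ‖T.op t x₀‖₊ := nnnorm_sub_le _ _
        _ ≤ _ := add_le_add hx' (hT x₀ t)
        _ = _ := by abel
  -- Nothing is assumed about β(0,·), so a bound uniform in t has to come from some x₀ ≠ 0. The zero
  -- space is treated apart.
  rcases subsingleton_or_nontrivial X with hX | hX
  · refine ⟨0, θ, hθ.1.2.2.monotone, fun t u hu => ?_⟩
    obtain ⟨x, hx, -⟩ := key 0 t u hu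
    exact ⟨x, hx, by simp [Subsingleton.elim x 0]⟩
  · obtain ⟨x₀, hx₀⟩ := exists_ne (0 : X)
    refine ⟨β x₀ 0 + β x₀ 0, θ, hθ.1.2.2.monotone, fun t u hu => ?_⟩
    obtain ⟨x, hx, hx'⟩ := key x₀ t u hu
    have : β x₀ t ≤ β x₀ 0 := (hβ x₀ hx₀).2.1.antitone zero_le
    exact ⟨x, hx, hx'.trans (by gcongr)⟩

/-- Applies the nonlinear estimate to v/k, whose modular is at most 1, and scales back by linearity.
K depends on t only through L, the bound for at + 1. -/
theorem IsSIISSWith.exists_le_mul_luxemburgNorm {m Φ : ℝ≥0 → ℝ≥0} (h : IsSIISSWith T B m)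
    (hΦ : IsYoung Φ) {a : ℝ≥0} (hm : ∀ x, m x ≤ a + Φ x) (L : ℝ≥0) :
    ∃ K : ℝ≥0, ∀ t : ℝ≥0, a * t + 1 ≤ L → ∀ v : ℝ → U, MemLp v ∞ (intervalMeasure t) →
      ∃ x : X, T.embed lam x = inputMap T B t v ∧ ‖x‖₊ ≤ K * luxemburgNorm Φ t v := by
  obtain ⟨C, θ, hθ, H⟩ := h.exists_inputMap_le
  refine ⟨C + θ L, fun t ht v hv => ?_⟩
  obtain ⟨x, hx, -⟩ := H t v hv
  refine ⟨x, hx, (hv.memOrlicz hΦ).le_mul_luxemburgNorm hΦ fun k hk hk' => ?_⟩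
  obtain ⟨y, hy, hy'⟩ := H t ((((k⁻¹ : ℝ≥0) : ℝ) : 𝕜) • v) (hv.const_smul _)
  rw [inputMap_smul, ← hx, ← map_smul] at hy
  obtain rfl := T.embed_injective lam hy
  have hn : ‖(((k⁻¹ : ℝ≥0) : ℝ) : 𝕜)‖₊ = k⁻¹ := by
    ext
    simp
  have hle : (∫⁻ s, (m ‖((((k⁻¹ : ℝ≥0) : ℝ) : 𝕜) • v) s‖₊ : ℝ≥0∞)
      ∂(intervalMeasure t)).toNNReal ≤ L := by
    refine le_trans (ENNReal.toNNReal_mono (b := (L : ℝ≥0∞)) ENNReal.coe_ne_top ?_) (by simp)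
    calc _ ≤ ∫⁻ s, ((a : ℝ≥0∞) + (Φ (k⁻¹ * ‖v s‖₊) : ℝ≥0∞)) ∂(intervalMeasure t) := by
          refine lintegral_mono fun s => ?_
          rw [← ENNReal.coe_add, Pi.smul_apply, nnnorm_smul, hn]
          exact ENNReal.coe_le_coe.2 (hm _)
      _ = a * t + modular Φ t k v := by
          rw [lintegral_add_left measurable_const, lintegral_const, intervalMeasure_univ, modular]
      _ ≤ a * t + 1 := by gcongr
      _ ≤ L := by exact_mod_cast ENNReal.coe_le_coe.2 ht
  have h1 := hy'.trans (add_le_add_right (hθ hle) C)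
  rw [nnnorm_smul, hn, inv_mul_le_iff₀ hk] at h1
  rwa [mul_comm]

variable [CompleteSpace X]

/-- A bound on bounded inputs extends to `E_Φ`. -/
theorem exists_state_of_memE {Φ : ℝ≥0 → ℝ≥0} (hΦ : IsYoung Φ) {t K : ℝ≥0}
    (H : ∀ v : ℝ → U, MemLp v ∞ (intervalMeasure t) →
      ∃ x : X, T.embed lam x = inputMap T B t v ∧ ‖x‖₊ ≤ K * luxemburgNorm Φ t v)
    {u : ℝ → U} (hu : MemE Φ t u) :
    ∃ x : X, T.embed lam x = inputMap T B t u ∧ ‖x‖₊ ≤ K * luxemburgNorm Φ t u := by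
  have hpos (n : ℕ) : (0 : ℝ≥0) < 1 / ((n : ℝ≥0) + 1) := by positivity
  choose v hv hvu using fun n : ℕ => hu.2 _ (hpos n)
  choose x hx hxK using fun n => H (v n) (hv n)
  have hO (n : ℕ) : MemOrlicz Φ t (v n) := (hv n).memOrlicz hΦ
  have hlim : Tendsto (fun n : ℕ => 1 / ((n : ℝ≥0) + 1)) atTop (𝓝 0) := by
    rw [← NNReal.tendsto_coe]
    simpa using tendsto_one_div_add_atTop_nhds_zero_nat (𝕜 := ℝ)
  have hlux : Tendsto (fun n => luxemburgNorm Φ t (u - v n)) atTop (𝓝 0) :=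
    tendsto_of_tendsto_of_tendsto_of_le_of_le tendsto_const_nhds hlim (fun _ => zero_le)
      fun n => (hvu n).le
  have hdist (i j : ℕ) : dist (x i) (x j) ≤
      K * (luxemburgNorm Φ t (u - v i) + luxemburgNorm Φ t (u - v j) : ℝ≥0) := by
    -- The bound for the difference of two bounded approximants makes their states a Cauchy sequence
    -- in X.
    obtain ⟨y, hy, hy'⟩ := H (v i - v j) ((hv i).sub (hv j))
    rw [inputMap_sub T B ((hO i).integrable hΦ) ((hO j).integrable hΦ), ← hx, ← hx,
      ← map_sub] at hy
    obtain rfl := T.embed_injective lam hy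
    have e : v i - v j = (u - v j) - (u - v i) := by abel
    have h1 := luxemburgNorm_sub_le hΦ (hu.1.sub hΦ (hO j)) (hu.1.sub hΦ (hO i))
    rw [← e, add_comm] at h1
    rw [dist_eq_norm]
    exact_mod_cast hy'.trans (mul_le_mul_right h1 K)
  have hcauchy : CauchySeq x := by
    refine cauchySeq_of_le_tendsto_0 (fun n : ℕ => (K * (1 / ((n : ℝ≥0) + 1) +
      1 / ((n : ℝ≥0) + 1)) : ℝ≥0)) (fun i j N hi hj => (hdist i j).trans ?_) ?_
    · have hle (i N : ℕ) (h : N ≤ i) : luxemburgNorm Φ t (u - v i) ≤ 1 / ((N : ℝ≥0) + 1) := by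
        refine (hvu i).le.trans ?_
        gcongr
      exact_mod_cast mul_le_mul_right (add_le_add (hle i N hi) (hle j N hj)) K
    · have := (hlim.add hlim).const_mul K
      simpa using NNReal.tendsto_coe.2 this
  obtain ⟨y, hy⟩ := cauchySeq_tendsto_of_complete hcauchy
  obtain ⟨M, hM⟩ := exists_norm_inputMap_le T B t
  obtain ⟨D, hD⟩ := exists_integral_norm_le U hΦ t
  refine ⟨y, ?_, ?_⟩
  -- In X₋₁ the same states converge to the input map of u, since Luxemburg convergence implies L¹
  -- convergence.
  · refine tendsto_nhds_unique (((T.embed lam).continuous.tendsto y).comp hy) ?_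
    rw [tendsto_iff_norm_sub_tendsto_zero]
    have h0 : Tendsto (fun n => (M * (D * luxemburgNorm Φ t (u - v n)) : ℝ≥0)) atTop (𝓝 0) := by
      simpa using (hlux.const_mul D).const_mul M
    refine squeeze_zero (fun _ => norm_nonneg _) (fun n => ?_)
      (by simpa using NNReal.tendsto_coe.2 h0)
    have hOn := hu.1.sub hΦ (hO n)
    rw [Function.comp_apply, hx, norm_sub_rev,
      ← inputMap_sub T B (hu.1.integrable hΦ) ((hO n).integrable hΦ)]
    refine (hM _ (hOn.integrable hΦ)).trans ?_
    exact mul_le_mul_of_nonneg_left (hD _ hOn) M.2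
  · have h1 (n : ℕ) : ‖x n‖₊ ≤
        K * (luxemburgNorm Φ t u + luxemburgNorm Φ t (u - v n)) := by
      refine (hxK n).trans (mul_le_mul_right ?_ K)
      have e : v n = u - (u - v n) := by abel
      conv_lhs => rw [e]
      exact luxemburgNorm_sub_le hΦ hu.1 (hu.1.sub hΦ (hO n))
    refine le_of_tendsto_of_tendsto' hy.nnnorm ?_ h1
    simpa using (hlux.const_add (luxemburgNorm Φ t u)).const_mul K

/-- If `m` is dominated by a constant plus a Young function `Φ`, a system that is siISS with `m`
is `E_Φ`-admissible. -/
theorem IsSIISSWith.isAdmissible {m Φ : ℝ≥0 → ℝ≥0} (h : IsSIISSWith T B m)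
    (hΦ : IsYoung Φ) {a : ℝ≥0} (hm : ∀ x, m x ≤ a + Φ x) : IsAdmissible T B Φ := by
  intro t _ u hu
  obtain ⟨K, hK⟩ := h.exists_le_mul_luxemburgNorm hΦ hm (a * t + 1)
  obtain ⟨x, hx, -⟩ := exists_state_of_memE hΦ (hK t le_rfl) hu
  exact ⟨x, hx⟩

/-- With Φ = m the additive constant a is 0, so L = 1 serves all t at once. -/
theorem IsSIISSWith.exists_uniform_bound {m : ℝ≥0 → ℝ≥0} (h : IsSIISSWith T B m)
    (hm : IsYoung m) : ∃ K : ℝ≥0, ∀ (t : ℝ≥0) (u : ℝ → U), MemE m t u →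
      ∃ x : X, T.embed lam x = inputMap T B t u ∧ ‖x‖₊ ≤ K * luxemburgNorm m t u := by
  obtain ⟨K, hK⟩ := h.exists_le_mul_luxemburgNorm hm (a := 0) (fun x => by simp) 1
  exact ⟨K, fun t u hu => exists_state_of_memE hm (hK t (by simp)) hu⟩

theorem IsSIISSWith.isInfTimeAdmissible {m : ℝ≥0 → ℝ≥0} (h : IsSIISSWith T B m)
    (hm : IsYoung m) : IsInfTimeAdmissible T B m := by
  obtain ⟨K, hK⟩ := h.exists_uniform_bound hm
  refine ⟨h.isAdmissible hm (a := 0) fun x => by simp, K, fun t _ u hu x hx => ?_⟩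
  obtain ⟨y, hy, hy'⟩ := hK t u hu
  rwa [T.embed_injective lam (hx.trans hy.symm)]

theorem IsSIISSWith.isSISS {m : ℝ≥0 → ℝ≥0} (h : IsSIISSWith T B m)
    (hm : IsYoung m) : IsSISS T B m := by
  obtain ⟨K, hK⟩ := h.exists_uniform_bound hm
  obtain ⟨-, -, β, hβ, hT, -⟩ := h.exists_decay
  -- The factor K + 1 in place of K keeps the gain strictly increasing when K = 0.
  refine ⟨fun r => (K + 1) * r, ⟨by simp, by fun_prop, fun r s hrs => ?_⟩, β, hβ,
    fun t x₀ u hu => ?_⟩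
  · dsimp only
    gcongr
  · obtain ⟨x, hx, hx'⟩ := hK t _ hu.comp_sub
    rw [luxemburgNorm_comp_sub] at hx'
    refine ⟨T.op t x₀ + x, by rw [map_add, hx, mildSolution_eq], ?_⟩
    refine (nnnorm_add_le _ _).trans (add_le_add (hT x₀ t) (hx'.trans ?_))
    dsimp only
    gcongr
    simp

end System

end LinSys

theorem theorem3p5 {𝕜 : Type*} [RCLike 𝕜]
    {X : Type*} [NormedAddCommGroup X] [NormedSpace 𝕜 X] [CompleteSpace X]
    {U : Type*} [NormedAddCommGroup U] [NormedSpace 𝕜 U] [CompleteSpace U]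
    (T : LinSys.C0Semigroup 𝕜 X) (lam : LinSys.resolventSet T.generator)
    (B : U →L[𝕜] T.Extrap lam) :
    (LinSys.IsSIISS T B →
      ∃ Φ : ℝ≥0 → ℝ≥0, LinSys.IsYoung Φ ∧ LinSys.IsAdmissible T B Φ) ∧
    (∀ μ : ℝ≥0 → ℝ≥0, LinSys.IsYoung μ → LinSys.IsSIISSWith T B μ →
      LinSys.IsSISS T B μ ∧ LinSys.IsInfTimeAdmissible T B μ) := by
  refine ⟨fun ⟨m, hm⟩ => ?_, fun μ hμ h => ⟨h.isSISS hμ, h.isInfTimeAdmissible hμ⟩⟩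
  obtain ⟨Φ, hΦ, hle⟩ := LinSys.ClassK.exists_young hm.1
  exact ⟨Φ, hΦ, hm.isAdmissible hΦ hle⟩
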